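/- **Setting.** Consider finite two-player zero-sum extensive-form games with chance and perfect recall. For player $i\in\{1,2\}$ let $\mathcal I_i$ be the set of information sets at which $i$ acts, $A(I)$ the set of actions at $I$, $|\mathcal I|=|\mathcal I_1|+|\mathcal I_2|$, $|\mathcal A|=\max_I|A(I)|$, and $\Delta=\max_i(\max_z u_i(z)-\min_z u_i(z))$, where $z$ ranges over the terminal histories. For a strategy profile $\sigma$ let $\pi_i^\sigma(h)$ and $\pi_{-i}^\sigma(h)$ be the contributions of player $i$ and of everybody else (chance included) to the probability of reaching the history $h$, $\pi_i^\sigma(I)=\sum_{h\in I}\pi_i^\sigma(h)$, and $\pi^\sigma(h,z)$ the probability of going from $h$ to $z$ (zero unless $h$ is a prefix of $z$). The instantaneous regrets of $\sigma$ at $I\in\mathcal I_i$ are $$r_i^\sigma(I,a)=\sum_{h\in I}\pi_{-i}^\sigma(h)\sum_z\pi^\sigma(h\cdot a,z)\,u_i(z)-\sum_{h\in I}\pi_{-i}^\sigma(h)\sum_z\pi^\sigma(h,z)\,u_i(z).$$ **HS-PCFR$^+$ with simultaneous updates** and schedule $\gamma_1,\gamma_2,\ldots$: put $R_i^0=r_i^0=C_i^0=0$.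 In iteration $t+1$ $(t=0,1,\ldots)$, for both players $i$, all $I\in\mathcal I_i$ and all $a\in A(I)$: $\sigma_i^{t+1}(I,a)$ is proportional to $\max(R_i^t(I,a)+r_i^t(I,a),0)$ over $a\in A(I)$ (uniform if all these numbers are $0$); with $r_i^{t+1}=r_i^{\sigma^{t+1}}$, $$R_i^{t+1}(I,a)=\max\bigl(R_i^t(I,a)+r_i^{t+1}(I,a),\,0\bigr),\qquad C_i^{t+1}(I,a)=C_i^t(I,a)\Bigl(\tfrac{t}{t+1}\Bigr)^{\gamma_{t+1}}+\pi_i^{\sigma^{t+1}}(I)\,\sigma_i^{t+1}(I,a).$$ The weighted average profile $\bar\sigma^T$ after $T$ iterations has $\bar\sigma_i^T(I,a)$ proportional to $C_i^T(I,a)$ over $a\in A(I)$ (uniform if all these numbers are $0$). **$\varepsilon$-Nash equilibrium.** Write $-i$ for the opponent of $i$. The exploitability of $\sigma_i$ is $e(\sigma_i)=\min_{\tau}u_i(\sigma_i^*,\tau)-\min_{\tau}u_i(\sigma_i,\tau)$, where $\sigma^*$ is a Nash equilibrium and $\tau$ ranges over the strategies of $-i$. A profile $\sigma$ is an $\varepsilon$-Nash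 equilibrium if no player can gain more than $\varepsilon$ in expected utility by deviating from $\sigma$, and $e(\sigma_i)\le\varepsilon$ for both players (for every choice of $\sigma^*$). **Theorem 3.2.** There is a function $C(\Delta,|\mathcal A|)$ such that for every such game, every $T\ge1$, every real $U$ and every schedule with $\gamma_t\in[0,U]$ for $1\le t\le T$, the weighted average strategy profile $\bar\sigma^T$ of HS-PCFR$^+$ with simultaneous updates is an $$\frac{(U+1)\,|\mathcal I|\;C(\Delta,|\mathcal A|)}{\sqrt T}\text{-Nash equilibrium}.$$ -/

import Mathlib

noncomputable section

/-- A finite two-player extensive-form game with chance. A history is the list of actions taken so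
far; `hist` is the (finite, prefix-closed) set of all histories. `turn h` is the player who acts at
a non-terminal history `h`, with `none` for chance. Two non-terminal histories at which player `i`
acts are in the same information set of `i` iff they carry the same label `info h`.
Values of `turn`, `info`, `chance` and `util` outside their intended domain are never used. -/
structure ExtGame (α ι : Type*) [Fintype α] [DecidableEq α] [DecidableEq ι] where
  hist : Finset (List α)
  root_mem : [] ∈ hist
  prefix_closed : ∀ h a, h ++ [a] ∈ hist → h ∈ hist
  turn : List α → Option (Fin 2)
  info : List α → ι
  chance : List α → α → ℝ
  util : Fin 2 → List α → ℝ
  chance_nonneg : ∀ h a, turn h = none → h ++ [a] ∈ hist → 0 ≤ chance h a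
  chance_sum : ∀ h, turn h = none → (∃ a, h ++ [a] ∈ hist) →
    ∑ a with h ++ [a] ∈ hist, chance h a = 1
  same_actions : ∀ i h h', turn h = some i → turn h' = some i → info h = info h' →
    (∃ a, h ++ [a] ∈ hist) → (∃ a, h' ++ [a] ∈ hist) →
    ∀ a, h ++ [a] ∈ hist ↔ h' ++ [a] ∈ hist

namespace ExtGame

/-- The product of `f h' a` over all `h'`, `a` with `h ⊏ h' ++ [a] ⊑ h ++ l`. -/
def pathProd {α : Type*} (f : List α → α → ℝ) : List α → List α → ℝ
  | _, [] => 1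
  | h, a :: l => f h a * pathProd f (h ++ [a]) l

variable {α ι : Type*} [Fintype α] [DecidableEq α] [DecidableEq ι] (G : ExtGame α ι)

/-! ### The game -/

/-- The actions `A(h)` available at `h`. -/
def actions (h : List α) : Finset α := {a | h ++ [a] ∈ G.hist}

/-- The terminal histories `Z`. -/
def terminals : Finset (List α) := {z ∈ G.hist | G.actions z = ∅}

/-- The non-terminal histories at which player `i` acts. -/
def decisionHist (i : Fin 2) : Finset (List α) :=
  {h ∈ G.hist | G.turn h = some i ∧ (G.actions h).Nonempty}

/-- The (labels of the) information sets `𝓘_i` of player `i`. -/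
def infoSets (i : Fin 2) : Finset ι := (G.decisionHist i).image G.info

/-- The histories that make up the information set `I` of player `i`. -/
def members (i : Fin 2) (I : ι) : Finset (List α) := {h ∈ G.decisionHist i | G.info h = I}

/-- The actions `A(I)` available at an information set (all members have the same actions). -/
def infoActions (i : Fin 2) (I : ι) : Finset α := (G.members i I).biUnion G.actions

/-- `|𝓘|`, the total number of information sets. -/
def numInfoSets : ℕ := ∑ i, (G.infoSets i).card

/-- `|A|`, the largest number of actions at an information set. -/
def maxActions : ℕ :=
  Finset.univ.sup fun i => (G.infoSets i).sup fun I => (G.infoActions i I).card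

/-- `Δ_i`, the range of the utilities of player `i`. -/
def utilRange (i : Fin 2) : ℝ :=
  sSup (G.util i '' (G.terminals : Set (List α))) - sInf (G.util i '' (G.terminals : Set (List α)))

/-- `Δ = max_i Δ_i`. -/
def maxRange : ℝ := max (G.utilRange 0) (G.utilRange 1)

/-- The utilities of the two players sum to zero. -/
def IsZeroSum : Prop := ∀ z ∈ G.terminals, G.util 0 z + G.util 1 z = 0

/-- The sequence of pairs (information set of `i`, action of `i`) met when the actions in the second
list are played starting from the history given by the first list. -/
def ownSeq (i : Fin 2) : List α → List α → List (ι × α)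
  | _, [] => []
  | h, a :: l =>
      if G.turn h = some i then (G.info h, a) :: ownSeq i (h ++ [a]) l else ownSeq i (h ++ [a]) l

/-- Perfect recall: on the way to any two histories of one information set of a player, that player
has met the same information sets and taken the same actions, in the same order. -/
def PerfectRecall : Prop :=
  ∀ i, ∀ h ∈ G.decisionHist i, ∀ h' ∈ G.decisionHist i, G.info h = G.info h' →
    G.ownSeq i [] h = G.ownSeq i [] h'

/-! ### Strategies, reach probabilities, equilibria -/

/-- `s` is a strategy of player `i`: a probability distribution on `A(I)` for every information set
`I` of `i`. (The values `s I a` at other `I`, `a` are never used.) -/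
def IsStrategy (i : Fin 2) (s : ι → α → ℝ) : Prop :=
  ∀ I ∈ G.infoSets i, (∀ a ∈ G.infoActions i I, 0 ≤ s I a) ∧ ∑ a ∈ G.infoActions i I, s I a = 1

/-- `σ` is a strategy profile. -/
def IsProfile (σ : Fin 2 → ι → α → ℝ) : Prop := ∀ i, G.IsStrategy i (σ i)

/-- The probability `σ_{P(h)}(h, a)` that action `a` is taken at `h`. -/
def stepProb (σ : Fin 2 → ι → α → ℝ) (h : List α) (a : α) : ℝ :=
  match G.turn h with
  | none => G.chance h a
  | some i => σ i (G.info h) a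

/-- `π^σ(h)`. -/
def reach (σ : Fin 2 → ι → α → ℝ) (h : List α) : ℝ := pathProd (G.stepProb σ) [] h

/-- `π_i^σ(h)`, the contribution of player `i` to `π^σ(h)`. -/
def reachOwn (σ : Fin 2 → ι → α → ℝ) (i : Fin 2) (h : List α) : ℝ :=
  pathProd (fun g a => if G.turn g = some i then G.stepProb σ g a else 1) [] h

/-- `π_{-i}^σ(h)`, the contribution of everybody else, chance included, to `π^σ(h)`. -/
def reachOthers (σ : Fin 2 → ι → α → ℝ) (i : Fin 2) (h : List α) : ℝ :=
  pathProd (fun g a => if G.turn g = some i then 1 else G.stepProb σ g a) [] h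

/-- `π^σ(h, z)`, the probability of going from `h` to `z`; it is zero unless `h ⊑ z`. -/
def reachFrom (σ : Fin 2 → ι → α → ℝ) (h z : List α) : ℝ :=
  if h <+: z then pathProd (G.stepProb σ) h (z.drop h.length) else 0

/-- The expected utility `u_i(σ)`. -/
def expUtil (i : Fin 2) (σ : Fin 2 → ι → α → ℝ) : ℝ := ∑ z ∈ G.terminals, G.reach σ z * G.util i z

/-- Nash equilibria: each player plays a best response to the other. -/
def IsNash (σ : Fin 2 → ι → α → ℝ) : Prop :=
  G.IsProfile σ ∧ ∀ i s, G.IsStrategy i s → G.expUtil i (Function.update σ i s) ≤ G.expUtil i σ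

/-- `u_i(σ_i, BR(σ_i))` in a zero-sum game: what player `i` gets from `σ i` when the opponent
`1 - i` best-responds to it, that is, chooses the strategy that is worst for `i`. -/
def worstCase (i : Fin 2) (σ : Fin 2 → ι → α → ℝ) : ℝ :=
  ⨅ s : {s : ι → α → ℝ // G.IsStrategy (1 - i) s}, G.expUtil i (Function.update σ (1 - i) s.1)

/-- The exploitability of `σ i`, measured against an equilibrium `σs`:
`e(σ_i) = u_i(σs_i, BR(σs_i)) - u_i(σ_i, BR(σ_i))`. -/
def exploitability (σs : Fin 2 → ι → α → ℝ) (i : Fin 2) (σ : Fin 2 → ι → α → ℝ) : ℝ :=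
  G.worstCase i σs - G.worstCase i σ

/-- `ε`-Nash equilibria of a zero-sum game, in both usual senses: no player can gain more than `ε`
by deviating, and no player has exploitability higher than `ε`. -/
def IsEpsNash (ε : ℝ) (σ : Fin 2 → ι → α → ℝ) : Prop :=
  G.IsProfile σ ∧
  (∀ i s, G.IsStrategy i s → G.expUtil i (Function.update σ i s) ≤ G.expUtil i σ + ε) ∧
  (∀ σs, G.IsNash σs → ∀ i, G.exploitability σs i σ ≤ ε)

/-! ### Counterfactual values and regrets -/

/-- The counterfactual value `v_i^σ(I)`. -/
def cfValue (σ : Fin 2 → ι → α → ℝ) (i : Fin 2) (I : ι) : ℝ :=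
  ∑ h ∈ G.members i I, G.reachOthers σ i h * ∑ z ∈ G.terminals, G.reachFrom σ h z * G.util i z

/-- The counterfactual value `v_i^σ(I, a)`. -/
def cfActionValue (σ : Fin 2 → ι → α → ℝ) (i : Fin 2) (I : ι) (a : α) : ℝ :=
  ∑ h ∈ G.members i I,
    G.reachOthers σ i h * ∑ z ∈ G.terminals, G.reachFrom σ (h ++ [a]) z * G.util i z

/-- The instantaneous regrets `r_i(I, a) = v_i^σ(I, a) - v_i^σ(I)`. -/
def instRegret (σ : Fin 2 → ι → α → ℝ) (i : Fin 2) (I : ι) (a : α) : ℝ :=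
  G.cfActionValue σ i I a - G.cfValue σ i I

/-- The weights `w` on `A(I)` scaled to a probability distribution, or the uniform distribution if
their sum is not positive. -/
def normalize (i : Fin 2) (I : ι) (w : α → ℝ) (a : α) : ℝ :=
  if a ∈ G.infoActions i I then
    if 0 < ∑ b ∈ G.infoActions i I, w b then w a / ∑ b ∈ G.infoActions i I, w b
    else 1 / ((G.infoActions i I).card : ℝ)
  else 0

/-! ### HS-PCFR⁺ with simultaneous updates -/

/-- The strategy that predictive regret matching⁺ plays with accumulated regrets `R` and predicted
regrets `m`: proportional to `max (R + m) 0`. -/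
def prmPlus (R m : Fin 2 → ι → α → ℝ) : Fin 2 → ι → α → ℝ :=
  fun i I => G.normalize i I fun a => max (R i I a + m i I a) 0

/-- The accumulated regrets `R^t` (truncated at zero in each iteration) and the instantaneous
regrets `r^t` observed last, after `t` iterations. The latter are the prediction for iteration
`t + 1`: the utilities of iteration `t`, taken as prediction of the next utilities, minus the
expected utility under the current strategy. -/
def pcfrState : ℕ → (Fin 2 → ι → α → ℝ) × (Fin 2 → ι → α → ℝ)
  | 0 => (0, 0)
  | t + 1 =>
      let S := pcfrState t
      let r := G.instRegret (G.prmPlus S.1 S.2)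
      (fun i I a => max (S.1 i I a + r i I a) 0, r)

/-- The strategy profile `σ^{t+1}`, played in iteration `t + 1`. -/
def pcfrNext (t : ℕ) : Fin 2 → ι → α → ℝ := G.prmPlus (G.pcfrState t).1 (G.pcfrState t).2

/-- The cumulative strategy `C_i^t(I, a)`, where `γ t` is the value of the hyperparameter that the
schedule prescribes for iteration `t`:
`C^{t+1}(I, a) = C^t(I, a) * (t / (t+1)) ^ γ + π_i^{σ^{t+1}}(I) * σ_i^{t+1}(I, a)`. -/
def cumStrategy (γ : ℕ → ℝ) : ℕ → Fin 2 → ι → α → ℝ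
  | 0 => 0
  | t + 1 => fun i I a =>
      cumStrategy γ t i I a * ((t : ℝ) / ((t : ℝ) + 1)) ^ γ (t + 1) +
        (∑ h ∈ G.members i I, G.reachOwn (G.pcfrNext t) i h) * G.pcfrNext t i I a

/-- The weighted average strategy profile after `T` iterations of HS-PCFR⁺ with schedule `γ`. -/
def avgProfile (γ : ℕ → ℝ) (T : ℕ) : Fin 2 → ι → α → ℝ :=
  fun i I => G.normalize i I (G.cumStrategy γ T i I)

end ExtGame

end

/-!
Why the weighted averages converge: three ingredients combine, none of which needs the equilibrium
theory of zero-sum games.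

*Decomposition.* Summing expected one-step changes of the value `V` of the current profile over the
game tree (`sum_pathProd_mul_step`) shows that the gain of player `i` from deviating to `s` equals
`∑ I, π_i^s(I) ∑ a, s(I, a) r_i(I, a)` (`expUtil_update_sub`). The same telescoping, applied to the
play in which `i` steers towards `I`, shows that the counterfactual reach probabilities in `I` sum
to at most `1` (`sum_reachOthers_le_one`), so instantaneous regrets are at most `Δ` in size.

*Local regret.* The unnormalized strategy `max (R + m) 0` is orthogonal to the observed regrets, and
so each iteration increases the squared norm of the accumulated regrets at an information set by at
most the squared prediction error, which is at most `4 Δ² |A|` (`sq_max_add_le`,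
`sum_sq_pcfrState_le`). Hence `R^T ≤ 2 Δ √(|A| T)`. The discounts give later iterations larger
weights, so by induction on `T` the weighted sum of the instantaneous regrets is still bounded by
`R^T` (`sum_weight_mul_le`), while the weights sum to at least `T / (U + 1)` (`le_sum_weight`).

*Averaging.* By perfect recall the average strategy reaches every history with the weighted average
of the probabilities of the iterates (`ownReach_avgProfile`), so utilities against it are weighted
averages of utilities against the iterates. Adding the regret bounds of both players, whose
utilities under the iterates cancel, gives `expUtil_update_le`, from which both parts of the
equilibrium property follow with `C(Δ, |A|) = 2 Δ √|A|`.
-/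

noncomputable section

namespace ExtGame

/-! ### Products along paths -/

section PathProd

variable {α : Type*}

theorem pathProd_append_singleton (f : List α → α → ℝ) (h l : List α) (a : α) :
    pathProd f h (l ++ [a]) = pathProd f h l * f (h ++ l) a := by
  induction l generalizing h with
  | nil => simp [pathProd]
  | cons b l ih => simp [pathProd, ih, mul_assoc]

theorem pathProd_nil_append (f : List α → α → ℝ) (l : List α) (a : α) :
    pathProd f [] (l ++ [a]) = pathProd f [] l * f l a := by
  simpa using pathProd_append_singleton f [] l a

theorem pathProd_mul (f g : List α → α → ℝ) (h l : List α) :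
    pathProd (fun k a => f k a * g k a) h l = pathProd f h l * pathProd g h l := by
  induction l generalizing h with
  | nil => simp [pathProd]
  | cons b l ih => simp only [pathProd, ih]; ring

end PathProd

variable {α ι : Type*} [Fintype α] [DecidableEq α] [DecidableEq ι] (G : ExtGame α ι)

/-! ### Histories and information sets -/

theorem mem_actions {h : List α} {a : α} : a ∈ G.actions h ↔ h ++ [a] ∈ G.hist := by
  simp [actions]

theorem mem_hist_of_append (h l : List α) (hl : h ++ l ∈ G.hist) : h ∈ G.hist := by
  induction l using List.reverseRecOn with
  | nil => simpa using hl
  | append_singleton l a ih =>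
    exact ih (G.prefix_closed _ a (by simpa [List.append_assoc] using hl))

theorem mem_members {i : Fin 2} {I : ι} {h : List α} :
    h ∈ G.members i I ↔
      (h ∈ G.hist ∧ G.turn h = some i ∧ (G.actions h).Nonempty) ∧ G.info h = I := by
  simp [members, decisionHist]

theorem infoActions_eq {i : Fin 2} {I : ι} {h : List α} (hh : h ∈ G.members i I) :
    G.infoActions i I = G.actions h := by
  ext a
  simp only [infoActions, Finset.mem_biUnion]
  constructor
  · rintro ⟨h', hh', ha⟩
    obtain ⟨⟨_, t', ⟨b', n'⟩⟩, e'⟩ := G.mem_members.1 hh'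
    obtain ⟨⟨_, t, ⟨b, n⟩⟩, e⟩ := G.mem_members.1 hh
    rw [mem_actions] at *
    exact (G.same_actions i h' h t' t (e'.trans e.symm) ⟨b', n'⟩ ⟨b, n⟩ a).1 ha
  · exact fun ha => ⟨h, hh, ha⟩

theorem exists_mem_members {i : Fin 2} {I : ι} (hI : I ∈ G.infoSets i) :
    ∃ h, h ∈ G.members i I := by
  obtain ⟨h, hh, e⟩ := Finset.mem_image.1 hI
  exact ⟨h, by simp [members, hh, e]⟩

theorem info_mem_infoSets {i : Fin 2} {h : List α} (hh : h ∈ G.hist) (ht : G.turn h = some i)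
    (hn : (G.actions h).Nonempty) : G.info h ∈ G.infoSets i ∧ h ∈ G.members i (G.info h) :=
  ⟨Finset.mem_image_of_mem _ (by simp [decisionHist, hh, ht, hn]),
    G.mem_members.2 ⟨⟨hh, ht, hn⟩, rfl⟩⟩

theorem infoActions_nonempty {i : Fin 2} {I : ι} (hI : I ∈ G.infoSets i) :
    (G.infoActions i I).Nonempty := by
  obtain ⟨h, hh⟩ := G.exists_mem_members hI
  rw [G.infoActions_eq hh]
  exact (G.mem_members.1 hh).1.2.2

theorem terminals_nonempty : G.terminals.Nonempty := by
  obtain ⟨z, hz, hmax⟩ := Finset.exists_max_image G.hist List.length ⟨[], G.root_mem⟩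
  refine ⟨z, Finset.mem_filter.2 ⟨hz, Finset.eq_empty_of_forall_notMem fun a ha => ?_⟩⟩
  have := hmax _ (G.mem_actions.1 ha)
  simp at this

/-- Induction on the game tree from the leaves to the root. -/
theorem hist_induction {p : List α → Prop}
    (step : ∀ h ∈ G.hist, (∀ a ∈ G.actions h, p (h ++ [a])) → p h) : ∀ h ∈ G.hist, p h := by
  have key : ∀ n, ∀ h ∈ G.hist, G.hist.sup List.length ≤ h.length + n → p h := by
    intro n
    induction n with
    | zero =>
      intro h hh hn
      refine step h hh fun a ha => ?_
      have := Finset.le_sup (f := List.length) (G.mem_actions.1 ha)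
      rw [List.length_append, List.length_singleton] at this
      omega
    | succ n ih =>
      intro h hh hn
      exact step h hh fun a ha => ih _ (G.mem_actions.1 ha)
        (by rw [List.length_append, List.length_singleton]; omega)
  exact fun h hh => key _ h hh (Nat.le_add_left _ _)

/-- Every history other than the root is `h ++ [a]` for exactly one history `h` and action `a`. -/
theorem sum_hist_eq (φ : List α → ℝ) :
    ∑ h ∈ G.hist, φ h = φ [] + ∑ h ∈ G.hist, ∑ a ∈ G.actions h, φ (h ++ [a]) := by
  rw [← Finset.add_sum_erase _ _ G.root_mem, Finset.sum_sigma']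
  congr 1
  symm
  refine Finset.sum_bij (fun x _ => x.1 ++ [x.2]) ?_ ?_ ?_ (fun _ _ => rfl)
  · rintro ⟨h, a⟩ hx
    simp only [Finset.mem_sigma, mem_actions] at hx
    simp [hx.2]
  · rintro ⟨h, a⟩ _ ⟨h', a'⟩ _ e
    simpa using e
  · intro l hl
    obtain ⟨hne, hl⟩ := Finset.mem_erase.1 hl
    obtain rfl | ⟨h, a, rfl⟩ := List.eq_nil_or_concat' l
    · exact absurd rfl hne
    · exact ⟨⟨h, a⟩, by simp [mem_actions, hl, G.prefix_closed _ _ hl], rfl⟩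

/-- The expected change of a potential `φ` along a play that starts at the root and takes action `a`
at `h` with probability `f h a`, written as the sum of the expected changes in the single steps. -/
theorem sum_pathProd_mul_step (f : List α → α → ℝ) (φ : List α → ℝ) :
    ∑ h ∈ G.hist with (G.actions h).Nonempty,
        pathProd f [] h * (∑ a ∈ G.actions h, f h a * φ (h ++ [a]) - φ h) =
      ∑ z ∈ G.terminals, pathProd f [] z * φ z - φ [] := by
  have h1 := G.sum_hist_eq fun h => pathProd f [] h * φ h
  have h2 := Finset.sum_filter_add_sum_filter_not G.hist (fun h => (G.actions h).Nonempty)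
    fun h => pathProd f [] h * φ h
  have h3 : ∑ h ∈ G.hist, ∑ a ∈ G.actions h, pathProd f [] (h ++ [a]) * φ (h ++ [a]) =
      ∑ h ∈ G.hist with (G.actions h).Nonempty,
        ∑ a ∈ G.actions h, pathProd f [] (h ++ [a]) * φ (h ++ [a]) := by
    rw [Finset.sum_filter]
    refine Finset.sum_congr rfl fun h _ => ?_
    split_ifs with hn
    · rfl
    · simp [Finset.not_nonempty_iff_eq_empty.1 hn]
  have h4 : G.terminals = {h ∈ G.hist | ¬ (G.actions h).Nonempty} := by
    simp [terminals, Finset.not_nonempty_iff_eq_empty]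
  simp only [mul_sub, Finset.sum_sub_distrib, Finset.mul_sum, ← mul_assoc,
    ← pathProd_nil_append]
  rw [h4]
  simp only [pathProd, one_mul] at h1
  linarith

/-! ### Reach probabilities -/

/-- The contribution to reach probabilities of a single strategy `s` of player `i`. -/
def ownReach (i : Fin 2) (s : ι → α → ℝ) (h : List α) : ℝ :=
  pathProd (fun g a => if G.turn g = some i then s (G.info g) a else 1) [] h

/-- The contribution of chance to reach probabilities. -/
def chanceReach (h : List α) : ℝ :=
  pathProd (fun g a => if G.turn g = none then G.chance g a else 1) [] h

theorem reachOwn_eq (σ : Fin 2 → ι → α → ℝ) (i : Fin 2) (h : List α) :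
    G.reachOwn σ i h = G.ownReach i (σ i) h := by
  unfold reachOwn ownReach
  congr 1
  funext g a
  split_ifs with hg
  · simp [stepProb, hg]
  · rfl

theorem reachOthers_eq (σ : Fin 2 → ι → α → ℝ) (i : Fin 2) (h : List α) :
    G.reachOthers σ i h = G.ownReach (1 - i) (σ (1 - i)) h * G.chanceReach h := by
  unfold reachOthers ownReach chanceReach
  rw [← pathProd_mul]
  congr 1
  funext g a
  unfold stepProb
  rcases hg : G.turn g with _ | j
  · simp
  · fin_cases i <;> fin_cases j <;> simp

theorem reach_eq (σ : Fin 2 → ι → α → ℝ) (i : Fin 2) (h : List α) :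
    G.reach σ h = G.ownReach i (σ i) h * G.reachOthers σ i h := by
  rw [← reachOwn_eq]
  unfold reach reachOthers reachOwn
  rw [← pathProd_mul]
  congr 1
  funext g a
  split_ifs <;> simp

theorem reach_update (σ : Fin 2 → ι → α → ℝ) (i : Fin 2) (s : ι → α → ℝ) (h : List α) :
    G.reach (Function.update σ i s) h = G.ownReach i s h * G.reachOthers σ i h := by
  have hi : 1 - i ≠ i := by fin_cases i <;> decide
  rw [G.reach_eq _ i, reachOthers_eq, reachOthers_eq, Function.update_self,
    Function.update_of_ne hi]

theorem ownSeq_append_singleton (i : Fin 2) (h l : List α) (a : α) :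
    G.ownSeq i h (l ++ [a]) = G.ownSeq i h l ++
      if G.turn (h ++ l) = some i then [(G.info (h ++ l), a)] else [] := by
  induction l generalizing h with
  | nil => simp [ownSeq]
  | cons b l ih =>
    simp only [List.cons_append, ownSeq, ih, List.append_assoc, List.nil_append]
    split_ifs <;> simp

theorem ownSeq_nil_append (i : Fin 2) (l : List α) (a : α) :
    G.ownSeq i [] (l ++ [a]) = G.ownSeq i [] l ++
      if G.turn l = some i then [(G.info l, a)] else [] := by
  simpa using G.ownSeq_append_singleton i [] l a

/-- The contribution of a player to the probability of reaching `h` depends only on what that player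
has seen and done on the way to `h`. -/
theorem ownReach_eq_prod (i : Fin 2) (s : ι → α → ℝ) (h : List α) :
    G.ownReach i s h = ((G.ownSeq i [] h).map fun p => s p.1 p.2).prod := by
  induction h using List.reverseRecOn with
  | nil => simp [ownReach, pathProd, ownSeq]
  | append_singleton h a ih =>
    unfold ownReach at ih ⊢
    rw [pathProd_nil_append, ih, ownSeq_nil_append]
    split_ifs <;> simp

theorem ownReach_congr (hG : G.PerfectRecall) {i : Fin 2} {I : ι} (s : ι → α → ℝ)
    {h h' : List α} (hh : h ∈ G.members i I) (hh' : h' ∈ G.members i I) :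
    G.ownReach i s h = G.ownReach i s h' := by
  obtain ⟨hd, e⟩ := Finset.mem_filter.1 hh
  obtain ⟨hd', e'⟩ := Finset.mem_filter.1 hh'
  rw [ownReach_eq_prod, ownReach_eq_prod, hG i h hd h' hd' (e.trans e'.symm)]

theorem strategy_nonneg_le_one {i : Fin 2} {s : ι → α → ℝ} (hs : G.IsStrategy i s) {h : List α}
    (ht : G.turn h = some i) {a : α} (ha : h ++ [a] ∈ G.hist) :
    0 ≤ s (G.info h) a ∧ s (G.info h) a ≤ 1 := by
  have hh := G.prefix_closed _ _ ha
  have haa := G.mem_actions.2 ha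
  obtain ⟨hI, hm⟩ := G.info_mem_infoSets hh ht ⟨a, haa⟩
  obtain ⟨h0, h1⟩ := hs _ hI
  rw [← G.infoActions_eq hm] at haa
  exact ⟨h0 a haa, h1 ▸ Finset.single_le_sum h0 haa⟩

theorem ownReach_nonneg_le_one {i : Fin 2} {s : ι → α → ℝ} (hs : G.IsStrategy i s) (h : List α)
    (hh : h ∈ G.hist) : 0 ≤ G.ownReach i s h ∧ G.ownReach i s h ≤ 1 := by
  induction h using List.reverseRecOn with
  | nil => simp [ownReach, pathProd]
  | append_singleton h a ih =>
    have ih := ih (G.prefix_closed _ _ hh)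
    unfold ownReach at ih ⊢
    rw [pathProd_nil_append]
    split_ifs with ht
    · have := G.strategy_nonneg_le_one hs ht hh
      exact ⟨mul_nonneg ih.1 this.1, mul_le_one₀ ih.2 this.1 this.2⟩
    · simpa using ih

theorem stepProb_nonneg {σ : Fin 2 → ι → α → ℝ} (hσ : G.IsProfile σ) {h : List α} {a : α}
    (ha : h ++ [a] ∈ G.hist) : 0 ≤ G.stepProb σ h a := by
  rcases ht : G.turn h with _ | i
  · simpa [stepProb, ht] using G.chance_nonneg h a ht ha
  · simpa [stepProb, ht] using (G.strategy_nonneg_le_one (hσ i) ht ha).1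

theorem sum_stepProb {σ : Fin 2 → ι → α → ℝ} (hσ : G.IsProfile σ) {h : List α} (hh : h ∈ G.hist)
    (hn : (G.actions h).Nonempty) : ∑ a ∈ G.actions h, G.stepProb σ h a = 1 := by
  rcases ht : G.turn h with _ | i
  · obtain ⟨a, ha⟩ := hn
    simpa [stepProb, ht, actions] using G.chance_sum h ht ⟨a, G.mem_actions.1 ha⟩
  · obtain ⟨hI, hm⟩ := G.info_mem_infoSets hh ht hn
    rw [← G.infoActions_eq hm]
    simpa [stepProb, ht] using (hσ i _ hI).2

theorem pathProd_nonneg {f : List α → α → ℝ}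
    (hf : ∀ h a, h ++ [a] ∈ G.hist → 0 ≤ f h a) (h : List α) (hh : h ∈ G.hist) :
    0 ≤ pathProd f [] h := by
  induction h using List.reverseRecOn with
  | nil => simp [pathProd]
  | append_singleton h a ih =>
    rw [pathProd_nil_append]
    exact mul_nonneg (ih (G.prefix_closed _ _ hh)) (hf _ _ hh)

theorem reachOthers_nonneg {σ : Fin 2 → ι → α → ℝ} (hσ : G.IsProfile σ) (i : Fin 2) {h : List α}
    (hh : h ∈ G.hist) : 0 ≤ G.reachOthers σ i h := by
  refine G.pathProd_nonneg (fun g a ha => ?_) h hh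
  split_ifs
  · exact zero_le_one
  · exact G.stepProb_nonneg hσ ha

/-- The counterfactual reach probabilities of the histories in an information set sum to at most
`1`: they are the probabilities of these histories in a play in which player `i` steers towards the
information set, and by perfect recall such a play meets it at most once. -/
theorem sum_reachOthers_le_one (hG : G.PerfectRecall) {σ : Fin 2 → ι → α → ℝ}
    (hσ : G.IsProfile σ) (i : Fin 2) (I : ι) : ∑ h ∈ G.members i I, G.reachOthers σ i h ≤ 1 := by
  rcases (G.members i I).eq_empty_or_nonempty with he | ⟨h₀, hh₀⟩
  · simp [he]
  set L := G.ownSeq i [] h₀ with hL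
  have hmem : ∀ h ∈ G.members i I, G.ownSeq i [] h = L := by
    intro h hh
    obtain ⟨hd, e⟩ := Finset.mem_filter.1 hh
    obtain ⟨hd₀, e₀⟩ := Finset.mem_filter.1 hh₀
    exact hG i h hd h₀ hd₀ (e.trans e₀.symm)
  -- player `i` takes the actions that `L` prescribes and stops playing when leaving `L`
  let f : List α → α → ℝ := fun g a =>
    if G.turn g = some i then (if G.ownSeq i [] (g ++ [a]) <+: L then 1 else 0)
    else G.stepProb σ g a
  have hf0 : ∀ g a, g ++ [a] ∈ G.hist → 0 ≤ f g a := by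
    intro g a ha
    simp only [f]
    split_ifs
    · exact zero_le_one
    · exact le_rfl
    · exact G.stepProb_nonneg hσ ha
  have hf1 : ∀ g ∈ G.hist, (G.actions g).Nonempty → ∑ a ∈ G.actions g, f g a ≤ 1 := by
    intro g hg hn
    by_cases ht : G.turn g = some i
    · simp only [f, ht, if_true]
      rw [Finset.sum_ite, Finset.sum_const_zero, add_zero, Finset.sum_const, nsmul_eq_mul, mul_one]
      have : ((G.actions g).filter fun a => G.ownSeq i [] (g ++ [a]) <+: L).card ≤ 1 := by
        refine Finset.card_le_one.2 fun a ha b hb => ?_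
        have ha := (Finset.mem_filter.1 ha).2
        have hb := (Finset.mem_filter.1 hb).2
        rw [ownSeq_nil_append, if_pos ht] at ha hb
        have := List.IsPrefix.eq_of_length
          (List.prefix_of_prefix_length_le ha hb (by simp)) (by simp)
        simpa using this
      exact_mod_cast this
    · simp only [f, ht, if_false]
      exact (G.sum_stepProb hσ hg hn).le
  have hfP : ∀ h, G.ownSeq i [] h <+: L → pathProd f [] h = G.reachOthers σ i h := by
    intro h
    induction h using List.reverseRecOn with
    | nil => simp [pathProd, reachOthers]
    | append_singleton h a ih =>
      intro hp
      have hp' : G.ownSeq i [] h <+: L := by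
        rw [ownSeq_nil_append] at hp
        exact (List.prefix_append _ _).trans hp
      unfold reachOthers at ih ⊢
      rw [pathProd_nil_append, pathProd_nil_append, ih hp']
      simp only [f, hp, if_true]
  let φ : List α → ℝ := fun h => if (G.ownSeq i [] h).length ≤ L.length then 1 else 0
  have hφ0 : ∀ h, 0 ≤ φ h := fun h => by simp only [φ]; split_ifs <;> simp
  have hφm : ∀ h a, φ (h ++ [a]) ≤ φ h := by
    intro h a
    simp only [φ, ownSeq_nil_append, List.length_append]
    split_ifs <;> first | omega | norm_num
  have tele := G.sum_pathProd_mul_step f φ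
  have hz : 0 ≤ ∑ z ∈ G.terminals, pathProd f [] z * φ z :=
    Finset.sum_nonneg fun z hz => mul_nonneg
      (G.pathProd_nonneg hf0 z (Finset.mem_filter.1 hz).1) (hφ0 z)
  have hφ1 : φ [] = 1 := by simp [φ, ownSeq]
  have hsub : G.members i I ⊆ {h ∈ G.hist | (G.actions h).Nonempty} := by
    intro h hh
    have := (G.mem_members.1 hh).1
    simp [this.1, this.2.2]
  have hle : ∑ h ∈ G.hist with (G.actions h).Nonempty,
        pathProd f [] h * (∑ a ∈ G.actions h, f h a * φ (h ++ [a]) - φ h) ≤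
      ∑ h ∈ G.hist with (G.actions h).Nonempty,
        if h ∈ G.members i I then - G.reachOthers σ i h else 0 := by
    refine Finset.sum_le_sum fun h hh => ?_
    obtain ⟨hh, hn⟩ := Finset.mem_filter.1 hh
    split_ifs with hI
    · -- one more own action makes the sequence longer than `L`, so the potential drops to zero
      have ht := (G.mem_members.1 hI).1.2.1
      have e1 : φ h = 1 := by simp [φ, hmem h hI]
      have e2 : ∀ a, φ (h ++ [a]) = 0 := by
        intro a
        simp [φ, ownSeq_nil_append, ht, hmem h hI]
      rw [hfP h (by rw [hmem h hI])]
      simp [e1, e2]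
    · refine mul_nonpos_of_nonneg_of_nonpos (G.pathProd_nonneg hf0 h hh) (sub_nonpos.2 ?_)
      calc ∑ a ∈ G.actions h, f h a * φ (h ++ [a]) ≤ ∑ a ∈ G.actions h, f h a * φ h :=
            Finset.sum_le_sum fun a ha =>
              mul_le_mul_of_nonneg_left (hφm h a) (hf0 h a (G.mem_actions.1 ha))
        _ = (∑ a ∈ G.actions h, f h a) * φ h := (Finset.sum_mul _ _ _).symm
        _ ≤ 1 * φ h := mul_le_mul_of_nonneg_right (hf1 h hh hn) (hφ0 h)
        _ = φ h := one_mul _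
  rw [← Finset.sum_filter, Finset.filter_mem_eq_inter, Finset.inter_eq_right.2 hsub,
    Finset.sum_neg_distrib, tele, hφ1] at hle
  linarith

/-! ### Values of histories and regrets -/

/-- The expected utility of player `i` when play under `σ` starts at `h`. -/
def value (σ : Fin 2 → ι → α → ℝ) (i : Fin 2) (h : List α) : ℝ :=
  ∑ z ∈ G.terminals, G.reachFrom σ h z * G.util i z

theorem value_terminal (σ : Fin 2 → ι → α → ℝ) (i : Fin 2) {h : List α} (hh : h ∈ G.terminals) :
    G.value σ i h = G.util i h := by
  unfold value
  rw [Finset.sum_eq_single_of_mem h hh]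
  · simp [reachFrom, pathProd]
  · intro z hz hne
    rw [reachFrom, if_neg, zero_mul]
    rintro ⟨l, rfl⟩
    cases l with
    | nil => simp at hne
    | cons a l =>
      have : h ++ [a] ∈ G.hist :=
        G.mem_hist_of_append _ l (by simpa using (Finset.mem_filter.1 hz).1)
      have ha := G.mem_actions.2 this
      rw [(Finset.mem_filter.1 hh).2] at ha
      simp at ha

theorem value_eq_sum (σ : Fin 2 → ι → α → ℝ) (i : Fin 2) {h : List α}
    (hn : (G.actions h).Nonempty) :
    G.value σ i h = ∑ a ∈ G.actions h, G.stepProb σ h a * G.value σ i (h ++ [a]) := by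
  unfold value
  simp only [Finset.mul_sum, ← mul_assoc]
  rw [Finset.sum_comm]
  refine Finset.sum_congr rfl fun z hz => ?_
  rw [← Finset.sum_mul]
  congr 1
  by_cases hp : h <+: z
  · obtain ⟨l, rfl⟩ := hp
    cases l with
    | nil =>
      have := (Finset.mem_filter.1 hz).2
      simp only [List.append_nil] at this
      simp [this] at hn
    | cons a l =>
      have ha : a ∈ G.actions h := G.mem_actions.2
        (G.mem_hist_of_append _ l (by simpa using (Finset.mem_filter.1 hz).1))
      rw [Finset.sum_eq_single_of_mem a ha]
      · have e : h ++ a :: l = (h ++ [a]) ++ l := by simp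
        rw [reachFrom, if_pos (List.prefix_append _ _), List.drop_left, pathProd, reachFrom, e,
          if_pos (List.prefix_append _ _), List.drop_left]
      · intro b _ hb
        rw [reachFrom, if_neg, mul_zero]
        rw [List.prefix_append_right_inj]
        simpa using hb
  · rw [reachFrom, if_neg hp]
    symm
    refine Finset.sum_eq_zero fun a _ => ?_
    rw [reachFrom, if_neg fun hpa => hp ((List.prefix_append _ _).trans hpa), mul_zero]

theorem expUtil_eq_value (σ : Fin 2 → ι → α → ℝ) (i : Fin 2) :
    G.expUtil i σ = G.value σ i [] := by
  simp [expUtil, value, reachFrom, reach]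

theorem value_mem_Icc {σ : Fin 2 → ι → α → ℝ} (hσ : G.IsProfile σ) (i : Fin 2) :
    ∀ h ∈ G.hist, G.value σ i h ∈
      Set.Icc (sInf (G.util i '' (G.terminals : Set (List α))))
        (sSup (G.util i '' (G.terminals : Set (List α)))) := by
  have hfin : (G.util i '' (G.terminals : Set (List α))).Finite :=
    (Finset.finite_toSet _).image _
  refine G.hist_induction fun h hh ih => ?_
  rcases (G.actions h).eq_empty_or_nonempty with he | hn
  · have hz : h ∈ G.terminals := Finset.mem_filter.2 ⟨hh, he⟩
    rw [G.value_terminal σ i hz]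
    have hm := Set.mem_image_of_mem (G.util i) (Finset.mem_coe.2 hz)
    exact ⟨csInf_le hfin.bddBelow hm, le_csSup hfin.bddAbove hm⟩
  · rw [G.value_eq_sum σ i hn]
    exact (convex_Icc _ _).sum_mem (fun a ha => G.stepProb_nonneg hσ (G.mem_actions.1 ha))
      (G.sum_stepProb hσ hh hn) ih

theorem utilRange_le_maxRange (i : Fin 2) : G.utilRange i ≤ G.maxRange := by
  fin_cases i
  · exact le_max_left _ _
  · exact le_max_right _ _

theorem abs_value_sub_le {σ : Fin 2 → ι → α → ℝ} (hσ : G.IsProfile σ) (i : Fin 2) {h h' : List α}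
    (hh : h ∈ G.hist) (hh' : h' ∈ G.hist) :
    |G.value σ i h - G.value σ i h'| ≤ G.maxRange :=
  (abs_sub_le_of_le_of_le (G.value_mem_Icc hσ i h hh).1 (G.value_mem_Icc hσ i h hh).2
    (G.value_mem_Icc hσ i h' hh').1 (G.value_mem_Icc hσ i h' hh').2).trans
    (G.utilRange_le_maxRange i)

theorem maxRange_nonneg : 0 ≤ G.maxRange := by
  refine le_trans ?_ (G.utilRange_le_maxRange 0)
  have hfin : (G.util 0 '' (G.terminals : Set (List α))).Finite :=
    (Finset.finite_toSet _).image _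
  exact sub_nonneg.2 (csInf_le_csSup (G.terminals_nonempty.to_set.image _)
    hfin.bddBelow hfin.bddAbove)

theorem instRegret_eq (σ : Fin 2 → ι → α → ℝ) (i : Fin 2) (I : ι) (a : α) :
    G.instRegret σ i I a = ∑ h ∈ G.members i I,
      G.reachOthers σ i h * (G.value σ i (h ++ [a]) - G.value σ i h) := by
  simp [instRegret, cfActionValue, cfValue, value, mul_sub]

theorem abs_instRegret_le (hG : G.PerfectRecall) {σ : Fin 2 → ι → α → ℝ} (hσ : G.IsProfile σ)
    {i : Fin 2} {I : ι} {a : α} (ha : a ∈ G.infoActions i I) :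
    |G.instRegret σ i I a| ≤ G.maxRange := by
  rw [instRegret_eq]
  calc |∑ h ∈ G.members i I, G.reachOthers σ i h * (G.value σ i (h ++ [a]) - G.value σ i h)|
      ≤ ∑ h ∈ G.members i I, |G.reachOthers σ i h * (G.value σ i (h ++ [a]) - G.value σ i h)| :=
        Finset.abs_sum_le_sum_abs _ _
    _ ≤ ∑ h ∈ G.members i I, G.reachOthers σ i h * G.maxRange := by
        refine Finset.sum_le_sum fun h hm => ?_
        have hh := (G.mem_members.1 hm).1.1
        have h0 := G.reachOthers_nonneg hσ i hh
        rw [G.infoActions_eq hm, mem_actions] at ha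
        rw [abs_mul, abs_of_nonneg h0]
        exact mul_le_mul_of_nonneg_left (G.abs_value_sub_le hσ i ha hh) h0
    _ ≤ G.maxRange := by
        rw [← Finset.sum_mul]
        exact mul_le_of_le_one_left G.maxRange_nonneg (G.sum_reachOthers_le_one hG hσ i I)

/-- The current strategy has no regret against itself. -/
theorem sum_mul_instRegret {σ : Fin 2 → ι → α → ℝ} (hσ : G.IsProfile σ) {i : Fin 2} {I : ι}
    (hI : I ∈ G.infoSets i) : ∑ a ∈ G.infoActions i I, σ i I a * G.instRegret σ i I a = 0 := by
  simp only [instRegret_eq, Finset.mul_sum]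
  rw [Finset.sum_comm]
  refine Finset.sum_eq_zero fun h hm => ?_
  obtain ⟨⟨hh, ht, hn⟩, rfl⟩ := G.mem_members.1 hm
  have hv := G.value_eq_sum σ i hn
  have h1 := G.sum_stepProb hσ hh hn
  simp only [stepProb, ht] at hv h1
  rw [G.infoActions_eq hm]
  calc ∑ a ∈ G.actions h, σ i (G.info h) a *
        (G.reachOthers σ i h * (G.value σ i (h ++ [a]) - G.value σ i h))
      = G.reachOthers σ i h * (∑ a ∈ G.actions h, σ i (G.info h) a * G.value σ i (h ++ [a]) -
          (∑ a ∈ G.actions h, σ i (G.info h) a) * G.value σ i h) := by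
        rw [Finset.sum_mul, ← Finset.sum_sub_distrib, Finset.mul_sum]
        exact Finset.sum_congr rfl fun a _ => by ring
    _ = 0 := by rw [h1, ← hv]; ring

theorem isProfile_update {σ : Fin 2 → ι → α → ℝ} (hσ : G.IsProfile σ) {i : Fin 2} {s : ι → α → ℝ}
    (hs : G.IsStrategy i s) : G.IsProfile (Function.update σ i s) := by
  intro j
  by_cases hj : j = i
  · subst hj; simpa using hs
  · simpa [Function.update_of_ne hj] using hσ j

/-- The gain of a deviation splits into the instantaneous regrets of the information sets, weighted
with the deviator's own contribution to reaching them. By perfect recall this contribution is the same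
for all histories of an information set `I`; it is read off at a representative `rep I`. -/
theorem expUtil_update_sub (hG : G.PerfectRecall) {σ : Fin 2 → ι → α → ℝ} {i : Fin 2}
    {s : ι → α → ℝ} (hs : G.IsStrategy i s) {rep : ι → List α}
    (hrep : ∀ I ∈ G.infoSets i, rep I ∈ G.members i I) :
    G.expUtil i (Function.update σ i s) - G.expUtil i σ =
      ∑ I ∈ G.infoSets i, G.ownReach i s (rep I) *
        ∑ a ∈ G.infoActions i I, s I a * G.instRegret σ i I a := by
  set τ := Function.update σ i s with hτ
  have tele := G.sum_pathProd_mul_step (G.stepProb τ) (G.value σ i)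
  have e1 : ∑ z ∈ G.terminals, pathProd (G.stepProb τ) [] z * G.value σ i z = G.expUtil i τ :=
    Finset.sum_congr rfl fun z hz => by rw [G.value_terminal σ i hz]; rfl
  rw [e1, ← expUtil_eq_value] at tele
  rw [← tele]
  have e2 : ∑ h ∈ G.hist with (G.actions h).Nonempty, pathProd (G.stepProb τ) [] h *
        (∑ a ∈ G.actions h, G.stepProb τ h a * G.value σ i (h ++ [a]) - G.value σ i h) =
      ∑ h ∈ G.decisionHist i, pathProd (G.stepProb τ) [] h *
        (∑ a ∈ G.actions h, G.stepProb τ h a * G.value σ i (h ++ [a]) - G.value σ i h) := by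
    symm
    refine Finset.sum_subset (fun h hh => ?_) fun h hh hd => ?_
    · simp only [decisionHist, Finset.mem_filter] at hh ⊢
      exact ⟨hh.1, hh.2.2⟩
    · obtain ⟨hh, hn⟩ := Finset.mem_filter.1 hh
      have ht : G.turn h ≠ some i := fun ht => hd (by simp [decisionHist, hh, ht, hn])
      have : G.stepProb τ h = G.stepProb σ h := by
        funext a
        unfold stepProb
        rcases hj : G.turn h with _ | j
        · rfl
        · have hji : j ≠ i := fun e => ht (by rw [hj, e])
          simp [hτ, Function.update_of_ne hji]
      rw [this, ← G.value_eq_sum σ i hn, sub_self, mul_zero]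
  rw [e2]
  rw [← Finset.sum_fiberwise_of_maps_to (g := G.info) (t := G.infoSets i)
    (fun h hh => Finset.mem_image_of_mem _ hh)]
  refine Finset.sum_congr rfl fun I hI => ?_
  simp only [instRegret_eq, Finset.mul_sum]
  rw [Finset.sum_comm' (t' := G.members i I) (s' := fun _ => G.infoActions i I)
    (by intros; tauto)]
  refine Finset.sum_congr rfl fun h hm => ?_
  have hmem : h ∈ G.members i I := hm
  obtain ⟨⟨hh, ht, hn⟩, rfl⟩ := G.mem_members.1 hmem
  have hsum : ∑ a ∈ G.actions h, s (G.info h) a = 1 := by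
    rw [← G.infoActions_eq hmem]; exact (hs _ hI).2
  have hr : pathProd (G.stepProb τ) [] h =
      G.ownReach i s (rep (G.info h)) * G.reachOthers σ i h := by
    rw [G.ownReach_congr hG s (hrep _ hI) hmem]
    exact G.reach_update σ i s h
  have hstep : ∀ a, G.stepProb τ h a = s (G.info h) a := by
    intro a
    simp [stepProb, ht, hτ]
  rw [hr, G.infoActions_eq hmem]
  simp only [hstep]
  calc _ = G.ownReach i s (rep (G.info h)) * G.reachOthers σ i h *
        (∑ a ∈ G.actions h, s (G.info h) a * G.value σ i (h ++ [a]) -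
          (∑ a ∈ G.actions h, s (G.info h) a) * G.value σ i h) := by rw [hsum, one_mul]
    _ = _ := by
      rw [Finset.sum_mul, ← Finset.sum_sub_distrib, Finset.mul_sum]
      exact Finset.sum_congr rfl fun a _ => by ring

/-! ### Discounted sums -/

section Discount

/-- The weight that iteration `t + 1` has after `T` iterations (for `t < T`): the product of the
discounts applied in the iterations `t + 2, …, T`. -/
def weight (γ : ℕ → ℝ) (T t : ℕ) : ℝ :=
  ∏ k ∈ Finset.Ico (t + 1) T, ((k : ℝ) / ((k : ℝ) + 1)) ^ γ (k + 1)

theorem weight_nonneg (γ : ℕ → ℝ) (T t : ℕ) : 0 ≤ weight γ T t :=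
  Finset.prod_nonneg fun _ _ => by positivity

theorem sum_weight_succ (γ : ℕ → ℝ) (T : ℕ) (f : ℕ → ℝ) :
    ∑ t ∈ Finset.range (T + 1), weight γ (T + 1) t * f t =
      (∑ t ∈ Finset.range T, weight γ T t * f t) * ((T : ℝ) / ((T : ℝ) + 1)) ^ γ (T + 1) + f T := by
  rw [Finset.sum_range_succ, Finset.sum_mul]
  congr 1
  · refine Finset.sum_congr rfl fun t ht => ?_
    have : t + 1 ≤ T := Finset.mem_range.1 ht
    rw [weight, Finset.prod_Ico_succ_top this, weight]
    ring
  · simp [weight]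

/-- Since the later iterations have the larger weights, the weighted sum of the increments of a
nonnegative sequence is at most its last member. -/
theorem sum_weight_mul_le {γ : ℕ → ℝ} {T : ℕ} (hγ : ∀ t, 1 ≤ t → t ≤ T → 0 ≤ γ t)
    {R r : ℕ → ℝ} (hR : ∀ t, 0 ≤ R t) (hr : ∀ t, R t + r t ≤ R (t + 1)) :
    ∑ t ∈ Finset.range T, weight γ T t * r t ≤ R T := by
  induction T with
  | zero => simpa using hR 0
  | succ T ih =>
    rw [sum_weight_succ]
    have h1 := ih fun t h1 h2 => hγ t h1 (by omega)
    have h2 : ((T : ℝ) / ((T : ℝ) + 1)) ^ γ (T + 1) ≤ 1 :=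
      Real.rpow_le_one (by positivity) (div_le_one_of_le₀ (by linarith) (by positivity))
        (hγ _ (by omega) le_rfl)
    have h3 : (0 : ℝ) ≤ ((T : ℝ) / ((T : ℝ) + 1)) ^ γ (T + 1) := by positivity
    calc _ ≤ R T * ((T : ℝ) / ((T : ℝ) + 1)) ^ γ (T + 1) + r T := by gcongr
      _ ≤ R T + r T := by gcongr; exact mul_le_of_le_one_right (hR T) h2
      _ ≤ R (T + 1) := hr T

theorem le_sum_weight {γ : ℕ → ℝ} {T : ℕ} {U : ℝ} (hU : 0 ≤ U)
    (hγ : ∀ t, 1 ≤ t → t ≤ T → γ t ≤ U) :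
    (T : ℝ) / (U + 1) ≤ ∑ t ∈ Finset.range T, weight γ T t := by
  induction T with
  | zero => simp
  | succ T ih =>
    have hs := sum_weight_succ γ T fun _ => 1
    simp only [mul_one] at hs
    rw [hs]
    rcases Nat.eq_zero_or_pos T with rfl | hT
    · simp only [zero_add, Nat.cast_one, Finset.range_zero, Finset.sum_empty, zero_mul]
      exact div_le_one_of_le₀ (by linarith) (by linarith)
    have hT' : (0 : ℝ) < T := by exact_mod_cast hT
    have h1 := ih fun t h1 h2 => hγ t h1 (by omega)
    set x : ℝ := (T : ℝ) / ((T : ℝ) + 1) with hx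
    have hx0 : 0 < x := by positivity
    have hx1 : x ≤ 1 := div_le_one_of_le₀ (by linarith) (by positivity)
    have h2 : x ^ U ≤ x ^ γ (T + 1) :=
      Real.rpow_le_rpow_of_exponent_ge hx0 hx1 (hγ _ (by omega) le_rfl)
    -- a Bernoulli inequality for the negative exponent: `x ^ U = (1 + 1 / T) ^ (-U)`
    have h3 : 1 - U / T ≤ x ^ U := by
      rw [Real.rpow_def_of_pos hx0]
      have hl := Real.one_sub_inv_le_log_of_pos hx0
      have hxi : 1 - x⁻¹ = - (1 / (T : ℝ)) := by rw [hx]; field_simp; ring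
      rw [hxi] at hl
      have := Real.add_one_le_exp (Real.log x * U)
      have h4 := mul_le_mul_of_nonneg_right hl hU
      have h5 : - (1 / (T : ℝ)) * U = - (U / T) := by ring
      linarith
    calc ((T + 1 : ℕ) : ℝ) / (U + 1) = (T : ℝ) / (U + 1) * (1 - U / T) + 1 := by
          push_cast; field_simp; ring
      _ ≤ (T : ℝ) / (U + 1) * x ^ γ (T + 1) + 1 := by
          have : 0 ≤ (T : ℝ) / (U + 1) := by positivity
          gcongr
          exact h3.trans h2
      _ ≤ _ := by gcongr

end Discount

/-! ### Predictive regret matching⁺ -/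

/-- One step of predictive regret matching⁺, coordinatewise: with accumulated regret `z`, prediction
`v` and observed regret `r`, where `max (z + v) 0` is the unnormalized next strategy. -/
theorem sq_max_add_le (z v r : ℝ) :
    max (z + r) 0 ^ 2 ≤ z ^ 2 + (r - v) ^ 2 + 2 * (max (z + v) 0 * r) := by
  rcases le_total (z + r) 0 with h1 | h1 <;> rcases le_total (z + v) 0 with h2 | h2
  · rw [max_eq_right h1, max_eq_right h2]; nlinarith
  · rw [max_eq_right h1, max_eq_left h2]; nlinarith [sq_nonneg (z + r), sq_nonneg v]
  · rw [max_eq_left h1, max_eq_right h2]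
    rcases le_total 0 r with h3 | h3
    · nlinarith [mul_nonneg h3 (neg_nonneg.2 h2), sq_nonneg v]
    · nlinarith [mul_nonneg (neg_nonneg.2 h3) h1, sq_nonneg (v - r), sq_nonneg r]
  · rw [max_eq_left h1, max_eq_left h2]; nlinarith [sq_nonneg v]

theorem isStrategy_normalize (i : Fin 2) {w : ι → α → ℝ}
    (hw : ∀ I, ∀ a ∈ G.infoActions i I, 0 ≤ w I a) :
    G.IsStrategy i fun I => G.normalize i I (w I) := by
  intro I hI
  have hne := G.infoActions_nonempty hI
  by_cases hp : 0 < ∑ b ∈ G.infoActions i I, w I b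
  · refine ⟨fun a ha => ?_, ?_⟩
    · simp only [normalize, ha, hp, if_true]
      exact div_nonneg (hw I a ha) hp.le
    · rw [Finset.sum_congr rfl fun a ha => by simp only [normalize, ha, hp, if_true]; rfl,
        ← Finset.sum_div, div_self hp.ne']
  · refine ⟨fun a ha => ?_, ?_⟩
    · simp only [normalize, ha, hp, if_true, if_false]
      positivity
    · rw [Finset.sum_congr rfl fun a ha => by simp only [normalize, ha, hp, if_true, if_false]; rfl,
        Finset.sum_const, nsmul_eq_mul, mul_one_div, div_self]
      exact_mod_cast hne.card_pos.ne'

/-- Regrets orthogonal to a normalized strategy are orthogonal to the weights it comes from: either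
the two are proportional, or the weights all vanish. -/
theorem sum_mul_eq_zero_of_normalize {i : Fin 2} {I : ι} {w r : α → ℝ}
    (hw : ∀ a ∈ G.infoActions i I, 0 ≤ w a)
    (h : ∑ a ∈ G.infoActions i I, G.normalize i I w a * r a = 0) :
    ∑ a ∈ G.infoActions i I, w a * r a = 0 := by
  by_cases hp : 0 < ∑ b ∈ G.infoActions i I, w b
  · rw [Finset.sum_congr rfl (g := fun a => w a * r a / ∑ b ∈ G.infoActions i I, w b)
      fun a ha => by simp only [normalize, ha, hp, if_true]; ring, ← Finset.sum_div] at h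
    exact (div_eq_zero_iff.1 h).resolve_right hp.ne'
  · have h0 := (Finset.sum_eq_zero_iff_of_nonneg hw).1
      (le_antisymm (not_lt.1 hp) (Finset.sum_nonneg hw))
    exact Finset.sum_eq_zero fun a ha => by rw [h0 a ha, zero_mul]

theorem isProfile_pcfrNext (t : ℕ) : G.IsProfile (G.pcfrNext t) := fun i =>
  G.isStrategy_normalize i
    (w := fun I a => max ((G.pcfrState t).1 i I a + (G.pcfrState t).2 i I a) 0)
    fun _ _ _ => le_max_right _ _

theorem pcfrState_fst_nonneg (t : ℕ) (i : Fin 2) (I : ι) (a : α) :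
    0 ≤ (G.pcfrState t).1 i I a := by
  cases t with
  | zero => exact le_rfl
  | succ t => exact le_max_right _ _

theorem abs_pcfrState_snd_le (hG : G.PerfectRecall) (t : ℕ) {i : Fin 2} {I : ι} {a : α}
    (ha : a ∈ G.infoActions i I) : |(G.pcfrState t).2 i I a| ≤ G.maxRange := by
  cases t with
  | zero => simpa [pcfrState] using G.maxRange_nonneg
  | succ t => exact G.abs_instRegret_le hG (G.isProfile_pcfrNext t) ha

theorem card_infoActions_le {i : Fin 2} {I : ι} (hI : I ∈ G.infoSets i) :
    (G.infoActions i I).card ≤ G.maxActions :=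
  (Finset.le_sup (f := fun I => (G.infoActions i I).card) hI).trans
    (Finset.le_sup (f := fun i => (G.infoSets i).sup fun I => (G.infoActions i I).card)
      (Finset.mem_univ i))

/-- The squared norm of the accumulated regrets grows by at most the squared prediction error in
each iteration. -/
theorem sum_sq_pcfrState_le (hG : G.PerfectRecall) (T : ℕ) {i : Fin 2} {I : ι}
    (hI : I ∈ G.infoSets i) :
    ∑ a ∈ G.infoActions i I, (G.pcfrState T).1 i I a ^ 2 ≤
      T * (G.maxActions * (2 * G.maxRange) ^ 2) := by
  induction T with
  | zero => simp [pcfrState]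
  | succ T ih =>
    set r := G.instRegret (G.pcfrNext T) i I with hr
    have horth : ∑ a ∈ G.infoActions i I,
        max ((G.pcfrState T).1 i I a + (G.pcfrState T).2 i I a) 0 * r a = 0 :=
      G.sum_mul_eq_zero_of_normalize (fun _ _ => le_max_right _ _)
        (G.sum_mul_instRegret (G.isProfile_pcfrNext T) hI)
    have herr : ∑ a ∈ G.infoActions i I, (r a - (G.pcfrState T).2 i I a) ^ 2 ≤
        G.maxActions * (2 * G.maxRange) ^ 2 := by
      calc _ ≤ ∑ a ∈ G.infoActions i I, (2 * G.maxRange) ^ 2 := by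
            refine Finset.sum_le_sum fun a ha => ?_
            have h1 := abs_le.1 (G.abs_instRegret_le hG (G.isProfile_pcfrNext T) ha)
            have h2 := abs_le.1 (G.abs_pcfrState_snd_le hG T ha)
            exact sq_le_sq' (by linarith [h1.1, h2.2]) (by linarith [h1.2, h2.1])
        _ ≤ _ := by
            rw [Finset.sum_const, nsmul_eq_mul]
            gcongr
            exact G.card_infoActions_le hI
    calc ∑ a ∈ G.infoActions i I, (G.pcfrState (T + 1)).1 i I a ^ 2
        ≤ ∑ a ∈ G.infoActions i I, ((G.pcfrState T).1 i I a ^ 2 +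
            (r a - (G.pcfrState T).2 i I a) ^ 2 +
            2 * (max ((G.pcfrState T).1 i I a + (G.pcfrState T).2 i I a) 0 * r a)) :=
          Finset.sum_le_sum fun a _ => sq_max_add_le _ _ _
      _ ≤ T * (G.maxActions * (2 * G.maxRange) ^ 2) + G.maxActions * (2 * G.maxRange) ^ 2 := by
          rw [Finset.sum_add_distrib, Finset.sum_add_distrib, ← Finset.mul_sum, horth]
          linarith
      _ = _ := by push_cast; ring

theorem pcfrState_fst_le (hG : G.PerfectRecall) (T : ℕ) {i : Fin 2} {I : ι}
    (hI : I ∈ G.infoSets i) {a : α} (ha : a ∈ G.infoActions i I) :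
    (G.pcfrState T).1 i I a ≤ 2 * G.maxRange * √G.maxActions * √T := by
  have hΔ := G.maxRange_nonneg
  refine le_of_sq_le_sq ?_ (by positivity)
  rw [mul_pow, mul_pow, Real.sq_sqrt (by positivity), Real.sq_sqrt (by positivity)]
  have h1 := Finset.single_le_sum (f := fun a => (G.pcfrState T).1 i I a ^ 2)
    (fun _ _ => sq_nonneg _) ha
  have h2 := G.sum_sq_pcfrState_le hG T hI
  exact h1.trans (h2.trans_eq (by ring))

/-- The weighted regret of a player for not having played a fixed strategy `s` throughout. It is at
most the sum over the information sets of the accumulated regrets `R^T`, because `R^t` grows by at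
least `r^{t+1}` and the weights increase with the iteration. -/
theorem sum_weight_mul_gain_le (hG : G.PerfectRecall) {γ : ℕ → ℝ} {T : ℕ}
    (hγ : ∀ t, 1 ≤ t → t ≤ T → 0 ≤ γ t) {i : Fin 2} {s : ι → α → ℝ} (hs : G.IsStrategy i s) :
    ∑ t ∈ Finset.range T, weight γ T t *
        (G.expUtil i (Function.update (G.pcfrNext t) i s) - G.expUtil i (G.pcfrNext t)) ≤
      (G.infoSets i).card * (2 * G.maxRange * √G.maxActions * √T) := by
  have hex : ∀ I, ∃ h, I ∈ G.infoSets i → h ∈ G.members i I := fun I => by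
    by_cases hI : I ∈ G.infoSets i
    · obtain ⟨h, hh⟩ := G.exists_mem_members hI
      exact ⟨h, fun _ => hh⟩
    · exact ⟨[], fun h => absurd h hI⟩
  choose rep hrep using hex
  set B := 2 * G.maxRange * √G.maxActions * √T with hB
  have hB0 : 0 ≤ B := by have := G.maxRange_nonneg; positivity
  calc _ = ∑ I ∈ G.infoSets i, G.ownReach i s (rep I) * ∑ a ∈ G.infoActions i I, s I a *
          ∑ t ∈ Finset.range T, weight γ T t * G.instRegret (G.pcfrNext t) i I a := by
        simp only [G.expUtil_update_sub hG hs hrep, Finset.mul_sum]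
        rw [Finset.sum_comm]
        refine Finset.sum_congr rfl fun I _ => ?_
        rw [Finset.sum_comm]
        refine Finset.sum_congr rfl fun a _ => Finset.sum_congr rfl fun t _ => by ring
    _ ≤ ∑ I ∈ G.infoSets i, B := by
        refine Finset.sum_le_sum fun I hI => ?_
        have hm := G.mem_members.1 (hrep I hI)
        obtain ⟨h0, h1⟩ := G.ownReach_nonneg_le_one hs _ hm.1.1
        have h2 : ∑ a ∈ G.infoActions i I, s I a *
            ∑ t ∈ Finset.range T, weight γ T t * G.instRegret (G.pcfrNext t) i I a ≤ B := by
          calc _ ≤ ∑ a ∈ G.infoActions i I, s I a * B := by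
                refine Finset.sum_le_sum fun a ha =>
                  mul_le_mul_of_nonneg_left ?_ ((hs I hI).1 a ha)
                refine le_trans ?_ (G.pcfrState_fst_le hG T hI ha)
                exact sum_weight_mul_le (R := fun t => (G.pcfrState t).1 i I a) hγ
                  (fun t => G.pcfrState_fst_nonneg t i I a) fun t => le_max_left _ _
            _ = B := by rw [← Finset.sum_mul, (hs I hI).2, one_mul]
        calc _ ≤ G.ownReach i s (rep I) * B := mul_le_mul_of_nonneg_left h2 h0
          _ ≤ B := mul_le_of_le_one_left hB0 h1
    _ = _ := by rw [Finset.sum_const, nsmul_eq_mul]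

/-! ### The weighted average profile -/

theorem cumStrategy_eq (hG : G.PerfectRecall) (γ : ℕ → ℝ) (T : ℕ) {i : Fin 2} {I : ι}
    {h : List α} (hh : h ∈ G.members i I) (a : α) :
    G.cumStrategy γ T i I a = (G.members i I).card * ∑ t ∈ Finset.range T,
      weight γ T t * (G.ownReach i (G.pcfrNext t i) h * G.pcfrNext t i I a) := by
  induction T with
  | zero => simp [cumStrategy]
  | succ T ih =>
    have hsum : ∑ h' ∈ G.members i I, G.reachOwn (G.pcfrNext T) i h' =
        (G.members i I).card * G.ownReach i (G.pcfrNext T i) h := by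
      rw [Finset.sum_congr rfl fun h' hh' =>
        (G.reachOwn_eq _ i h').trans (G.ownReach_congr hG _ hh' hh), Finset.sum_const,
        nsmul_eq_mul]
    simp only [cumStrategy]
    rw [ih, hsum, sum_weight_succ]
    ring

theorem cumStrategy_nonneg (hG : G.PerfectRecall) (γ : ℕ → ℝ) (T : ℕ) (i : Fin 2) (I : ι)
    {a : α} (ha : a ∈ G.infoActions i I) : 0 ≤ G.cumStrategy γ T i I a := by
  obtain ⟨h, hm, haa⟩ := Finset.mem_biUnion.1 ha
  rw [G.cumStrategy_eq hG γ T hm]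
  obtain ⟨⟨hh, ht, hn⟩, rfl⟩ := G.mem_members.1 hm
  refine mul_nonneg (Nat.cast_nonneg _) (Finset.sum_nonneg fun t _ =>
    mul_nonneg (weight_nonneg γ T t) (mul_nonneg ?_ ?_))
  · exact (G.ownReach_nonneg_le_one (G.isProfile_pcfrNext t i) h hh).1
  · exact (G.strategy_nonneg_le_one (G.isProfile_pcfrNext t i) ht (G.mem_actions.1 haa)).1

theorem isProfile_avgProfile (hG : G.PerfectRecall) (γ : ℕ → ℝ) (T : ℕ) :
    G.IsProfile (G.avgProfile γ T) := fun i =>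
  G.isStrategy_normalize i fun I _ ha => G.cumStrategy_nonneg hG γ T i I ha

/-- The average strategy reaches every history with the weighted average of the probabilities with
which the iterates reach it. -/
theorem ownReach_avgProfile (hG : G.PerfectRecall) (γ : ℕ → ℝ) (T : ℕ) (i : Fin 2)
    (h : List α) (hh : h ∈ G.hist) :
    (∑ t ∈ Finset.range T, weight γ T t) * G.ownReach i (G.avgProfile γ T i) h =
      ∑ t ∈ Finset.range T, weight γ T t * G.ownReach i (G.pcfrNext t i) h := by
  induction h using List.reverseRecOn with
  | nil => simp [ownReach, pathProd]
  | append_singleton h a ih =>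
    have hh' := G.prefix_closed _ _ hh
    have ih := ih hh'
    by_cases ht : G.turn h = some i
    · have happ : ∀ s : ι → α → ℝ,
          G.ownReach i s (h ++ [a]) = G.ownReach i s h * s (G.info h) a := by
        intro s
        simp [ownReach, pathProd_nil_append, ht]
      have haa := G.mem_actions.2 hh
      obtain ⟨hI, hm⟩ := G.info_mem_infoSets hh' ht ⟨a, haa⟩
      have hcard : (0 : ℝ) < (G.members i (G.info h)).card := by
        exact_mod_cast Finset.card_pos.2 ⟨h, hm⟩
      have hx : ∀ t, 0 ≤ weight γ T t * G.ownReach i (G.pcfrNext t i) h := fun t =>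
        mul_nonneg (weight_nonneg γ T t)
          (G.ownReach_nonneg_le_one (G.isProfile_pcfrNext t i) h hh').1
      have hC : ∑ b ∈ G.infoActions i (G.info h), G.cumStrategy γ T i (G.info h) b =
          (G.members i (G.info h)).card *
            ∑ t ∈ Finset.range T, weight γ T t * G.ownReach i (G.pcfrNext t i) h := by
        simp only [G.cumStrategy_eq hG γ T hm, ← Finset.mul_sum]
        rw [Finset.sum_comm]
        congr 1
        refine Finset.sum_congr rfl fun t _ => ?_
        rw [← Finset.mul_sum, ← Finset.mul_sum, (G.isProfile_pcfrNext t i _ hI).2, mul_one]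
      simp only [happ]
      rw [← mul_assoc, ih]
      set X := ∑ t ∈ Finset.range T, weight γ T t * G.ownReach i (G.pcfrNext t i) h with hX
      rcases (Finset.sum_nonneg fun t _ => hx t : 0 ≤ X).eq_or_lt with (h0 : 0 = X) | (hpos : 0 < X)
      · have hz := (Finset.sum_eq_zero_iff_of_nonneg fun t _ => hx t).1 h0.symm
        rw [← h0, zero_mul]
        exact (Finset.sum_eq_zero fun t ht => by rw [← mul_assoc, hz t ht, zero_mul]).symm
      · have hp : 0 < ∑ b ∈ G.infoActions i (G.info h), G.cumStrategy γ T i (G.info h) b := by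
          rw [hC]; positivity
        have ha' : a ∈ G.infoActions i (G.info h) := by rwa [G.infoActions_eq hm]
        rw [avgProfile, normalize, if_pos ha', if_pos hp, hC, G.cumStrategy_eq hG γ T hm]
        have e : ∑ t ∈ Finset.range T, weight γ T t *
            (G.ownReach i (G.pcfrNext t i) h * G.pcfrNext t i (G.info h) a) =
            X * ((G.members i (G.info h)).card * (∑ t ∈ Finset.range T, weight γ T t *
              (G.ownReach i (G.pcfrNext t i) h * G.pcfrNext t i (G.info h) a)) /
              ((G.members i (G.info h)).card * X)) := by
          rw [mul_div_mul_left _ _ hcard.ne', mul_div_cancel₀ _ hpos.ne']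
        exact e.symm
    · have happ : ∀ s : ι → α → ℝ, G.ownReach i s (h ++ [a]) = G.ownReach i s h := by
        intro s
        simp [ownReach, pathProd_nil_append, ht]
      simpa only [happ] using ih

theorem expUtil_update_eq (σ : Fin 2 → ι → α → ℝ) (i j : Fin 2) (s : ι → α → ℝ) :
    G.expUtil j (Function.update σ i s) = ∑ z ∈ G.terminals,
      G.ownReach (1 - i) (σ (1 - i)) z *
        (G.ownReach i s z * G.chanceReach z * G.util j z) := by
  unfold expUtil
  refine Finset.sum_congr rfl fun z _ => ?_
  rw [reach_update, reachOthers_eq]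
  ring

theorem expUtil_update_avgProfile (hG : G.PerfectRecall) (γ : ℕ → ℝ) (T : ℕ) (i j : Fin 2)
    (s : ι → α → ℝ) :
    (∑ t ∈ Finset.range T, weight γ T t) *
        G.expUtil j (Function.update (G.avgProfile γ T) i s) =
      ∑ t ∈ Finset.range T, weight γ T t * G.expUtil j (Function.update (G.pcfrNext t) i s) := by
  simp only [expUtil_update_eq]
  simp only [Finset.mul_sum (ι := List α)]
  rw [Finset.sum_comm (s := Finset.range T)]
  refine Finset.sum_congr rfl fun z hz => ?_
  rw [← mul_assoc,
    G.ownReach_avgProfile hG γ T _ z (Finset.mem_filter.1 hz).1, Finset.sum_mul]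
  exact Finset.sum_congr rfl fun t _ => by ring

/-! ### Equilibrium -/

theorem expUtil_one_sub (hz : G.IsZeroSum) (i : Fin 2) (σ : Fin 2 → ι → α → ℝ) :
    G.expUtil (1 - i) σ = - G.expUtil i σ := by
  unfold expUtil
  rw [← Finset.sum_neg_distrib]
  refine Finset.sum_congr rfl fun z hzz => ?_
  have := hz z hzz
  fin_cases i
  · change G.reach σ z * G.util 1 z = -(G.reach σ z * G.util 0 z)
    rw [eq_neg_of_add_eq_zero_right this]; ring
  · change G.reach σ z * G.util 0 z = -(G.reach σ z * G.util 1 z)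
    rw [eq_neg_of_add_eq_zero_left this]; ring

theorem numInfoSets_eq (i : Fin 2) :
    G.numInfoSets = (G.infoSets i).card + (G.infoSets (1 - i)).card := by
  unfold numInfoSets
  rw [Fin.sum_univ_two]
  fin_cases i
  · rfl
  · exact add_comm _ _

/-- Against the average profile, what `i` gets with any `s` exceeds what `i` is left with when the
opponent switches to any `s'` by at most the sum of both players' average regrets. -/
theorem expUtil_update_le (hz : G.IsZeroSum) (hG : G.PerfectRecall) {T : ℕ} {U : ℝ} {γ : ℕ → ℝ}
    (hT : 1 ≤ T) (hγ : ∀ t, 1 ≤ t → t ≤ T → 0 ≤ γ t ∧ γ t ≤ U) (i : Fin 2) {s s' : ι → α → ℝ}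
    (hs : G.IsStrategy i s) (hs' : G.IsStrategy (1 - i) s') :
    G.expUtil i (Function.update (G.avgProfile γ T) i s) ≤
      G.expUtil i (Function.update (G.avgProfile γ T) (1 - i) s') +
        (U + 1) * G.numInfoSets * (2 * G.maxRange * √G.maxActions) / √T := by
  have hU : 0 ≤ U := (hγ 1 le_rfl hT).1.trans (hγ 1 le_rfl hT).2
  have hT0 : (0 : ℝ) < T := by exact_mod_cast hT
  have h1 := G.sum_weight_mul_gain_le hG (fun t h h' => (hγ t h h').1) hs
  have h2 := G.sum_weight_mul_gain_le hG (fun t h h' => (hγ t h h').1) hs'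
  simp only [mul_sub, Finset.sum_sub_distrib, ← G.expUtil_update_avgProfile hG] at h1 h2
  simp only [G.expUtil_one_sub hz i, mul_neg, Finset.sum_neg_distrib] at h2
  have hW := le_sum_weight hU fun t h h' => (hγ t h h').2
  set W := ∑ t ∈ Finset.range T, weight γ T t with hWdef
  set x := G.expUtil i (Function.update (G.avgProfile γ T) i s)
  set y := G.expUtil i (Function.update (G.avgProfile γ T) (1 - i) s')
  set B := 2 * G.maxRange * √G.maxActions with hB
  have hB0 : 0 ≤ B := by have := G.maxRange_nonneg; positivity
  have hnum : (G.numInfoSets : ℝ) = (G.infoSets i).card + (G.infoSets (1 - i)).card := by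
    exact_mod_cast G.numInfoSets_eq i
  have h3 : W * (x - y) ≤ G.numInfoSets * (B * √T) := by rw [hnum]; linarith
  have hW0 : 0 < (T : ℝ) / (U + 1) := by positivity
  have h4 : x - y ≤ G.numInfoSets * (B * √T) / ((T : ℝ) / (U + 1)) := by
    rw [le_div_iff₀ hW0]
    rcases le_total 0 (x - y) with h | h
    · nlinarith
    · exact (mul_nonpos_of_nonpos_of_nonneg h hW0.le).trans (by positivity)
  have h5 : G.numInfoSets * (B * √T) / ((T : ℝ) / (U + 1)) =
      (U + 1) * G.numInfoSets * B / √T := by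
    have hs : √(T : ℝ) * √T = T := Real.mul_self_sqrt hT0.le
    have hs0 : √(T : ℝ) ≠ 0 := (Real.sqrt_pos.2 hT0).ne'
    rw [div_div_eq_mul_div, div_eq_div_iff hT0.ne' hs0]
    linear_combination (G.numInfoSets : ℝ) * B * (U + 1) * hs
  linarith

theorem worstCase_le {σ : Fin 2 → ι → α → ℝ} (hσ : G.IsProfile σ) (i : Fin 2) {s : ι → α → ℝ}
    (hs : G.IsStrategy (1 - i) s) :
    G.worstCase i σ ≤ G.expUtil i (Function.update σ (1 - i) s) := by
  refine ciInf_le (f := fun s : {s : ι → α → ℝ // G.IsStrategy (1 - i) s} =>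
    G.expUtil i (Function.update σ (1 - i) s.1)) ?_ ⟨s, hs⟩
  refine ⟨sInf (G.util i '' (G.terminals : Set (List α))), ?_⟩
  rintro _ ⟨s, rfl⟩
  simp only [expUtil_eq_value]
  exact (G.value_mem_Icc (G.isProfile_update hσ s.2) i [] G.root_mem).1

end ExtGame

end

theorem theorem3p2 :
    ∃ C : ℝ → ℕ → ℝ,
      ∀ (α : Type*) (ι : Type*) [Fintype α] [DecidableEq α] [DecidableEq ι] (G : ExtGame α ι),
        G.IsZeroSum → G.PerfectRecall →
        ∀ (T : ℕ) (U : ℝ) (γ : ℕ → ℝ), 1 ≤ T →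
          (∀ t, 1 ≤ t → t ≤ T → 0 ≤ γ t ∧ γ t ≤ U) →
          G.IsEpsNash
            ((U + 1) * (G.numInfoSets : ℝ) * C G.maxRange G.maxActions / Real.sqrt (T : ℝ))
            (G.avgProfile γ T) := by
  refine ⟨fun Δ A => 2 * Δ * √A, ?_⟩
  intro α ι _ _ _ G hz hG T U γ hT hγ
  have havg := G.isProfile_avgProfile hG γ T
  refine ⟨havg, fun i s hs => ?_, fun σs hσs i => ?_⟩
  · have := G.expUtil_update_le hz hG hT hγ i hs (havg (1 - i))
    rwa [Function.update_eq_self] at this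
  · unfold ExtGame.exploitability
    have : Nonempty {s : ι → α → ℝ // G.IsStrategy (1 - i) s} := ⟨⟨_, havg (1 - i)⟩⟩
    -- the equilibrium strategy of `i` against the average strategy of the opponent
    have hmix : Function.update (G.avgProfile γ T) i (σs i) =
        Function.update σs (1 - i) (G.avgProfile γ T (1 - i)) := by
      funext j
      fin_cases i <;> fin_cases j <;> simp
    have h1 := G.worstCase_le hσs.1 i (havg (1 - i))
    rw [← hmix] at h1
    have h2 : G.worstCase i σs - (U + 1) * (G.numInfoSets : ℝ) *
        (2 * G.maxRange * √G.maxActions) / √T ≤ G.worstCase i (G.avgProfile γ T) := by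
      refine le_ciInf fun s => ?_
      have := G.expUtil_update_le hz hG hT hγ i (hσs.1 i) s.2
      linarith
    linarith
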